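/- Let $\mathbb{R}_{\max}=\mathbb{R}\cup\{-\infty\}$, let $n\ge 1$, and let $A=(a_{ij}),B=(b_{ij})\in\mathbb{R}_{\max}^{m\times n}$ be such that neither $A$ nor $B$ has a row identically equal to $-\infty$ and no column is identically $-\infty$ in both $A$ and $B$. For $M\in\mathbb{R}_{\max}^{m\times n}$ write $(Mx)_i=\max_j(m_{ij}+x_j)$ and $(M^{\sharp}y)_j=\min_i(-m_{ij}+y_i)$, with the convention $(-\infty)+(+\infty)=+\infty$ in the latter. For a map $f:\mathbb{R}_{\max}^n\to\mathbb{R}_{\max}^n$ let $r(f)$ denote its greatest eigenvalue, $$r(f)=\max\{\mu\in\mathbb{R}_{\max}\mid \exists x\in\mathbb{R}_{\max}^n,\ x\not\equiv-\infty,\ \mu+x=f(x)\},$$ and for an $n\times n$ matrix $H$ let $r(H)$ be $r(x\mapsto Hx)$. For $\lambda\in\mathbb{R}$ put $$h_\lambda(x)=\min\bigl(\lambda+A^{\sharp}Bx,\ -\lambda+B^{\sharp}Ax\bigr)\quad\text{(componentwise)},\qquad s(\lambda)=r(h_\lambda).$$ A policy $p$ chooses for every $i\in\{1,\dots,n\}$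 either an index $k\in\{1,\dots,m\}$ with $a_{ki}\neq-\infty$ or an index $k\in\{1,\dots,m\}$ with $b_{ki}\ne-\infty$; $H_\lambda^{(p)}$ is the $n\times n$ matrix whose $i$-th row is $\lambda-a_{ki}+B_{k\cdot}$ in the first case and $-\lambda-b_{ki}+A_{k\cdot}$ in the second. A function $\mathbb{R}\to\mathbb{R}$ is called piecewise affine if $\mathbb{R}$ is a finite union of closed, possibly unbounded, intervals on each of which it is affine. Then: 1. For each policy $p$ and each $\lambda\in\mathbb{R}$ the greatest eigenvalue $r(H_\lambda^{(p)})$ exists and is finite, and $\lambda\mapsto r(H_\lambda^{(p)})$ is a convex, piecewise-affine, Lipschitz function on $\mathbb{R}$. 2. There are finitely many policies; for each $\lambda\in\mathbb{R}$ the greatest eigenvalue $s(\lambda)$ of $h_\lambda$ exists, and $s(\lambda)=\min_p r(H_\lambda^{(p)})$. The spectral function $s$ is a finite piecewise-affine Lipschitz function on $\mathbb{R}$. -/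

import Mathlib

/-!
Max-plus scalars `ℝ ∪ {-∞}` are the elements of `EReal` different from `⊤`; the value `⊤` occurs
only as an intermediate value of the residuated operator.
-/

noncomputable section

namespace MaxPlus

/-- The max-plus linear operator `x ↦ M ⊗ x`, `(M ⊗ x) i = max_j (M i j + x j)`. -/
def mulVec {m n : ℕ} (M : Matrix (Fin m) (Fin n) EReal) (x : Fin n → EReal) : Fin m → EReal :=
  fun i => ⨆ j, M i j + x j

/-- The residuated operator `(M♯ y) j = min_i (-(M i j) + y i)`, with the convention
`(-∞) + (+∞) = +∞`. As Mathlib's addition on `EReal` has `⊥ + ⊤ = ⊥`, the sum under this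
convention is written `-(M i j + -(y i))`. -/
def residuated {m n : ℕ} (M : Matrix (Fin m) (Fin n) EReal) (y : Fin m → EReal) : Fin n → EReal :=
  fun j => ⨅ i, -(M i j + -(y i))

/-- The eigenvalues in `ℝ ∪ {-∞}` of a self-map `f` of `(ℝ ∪ {-∞})ⁿ`: those `μ` for which
`μ + x = f x` for some vector `x` that is not identically `-∞`. -/
def eigenvalues {n : ℕ} (f : (Fin n → EReal) → (Fin n → EReal)) : Set EReal :=
  {μ | μ ≠ ⊤ ∧ ∃ x : Fin n → EReal, (∀ i, x i ≠ ⊤) ∧ (∃ i, x i ≠ ⊥) ∧ ∀ i, μ + x i = f x i}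

/-- The spectral radius `r(f)`: the greatest eigenvalue, taken as a supremum in `EReal`. -/
def spectralRadius {n : ℕ} (f : (Fin n → EReal) → (Fin n → EReal)) : EReal :=
  sSup (eigenvalues f)

/-- The min-max function `h_lam(x) = (lam + A♯ B x) ∧ (-lam + B♯ A x)`. -/
def minMaxMap {m n : ℕ} (A B : Matrix (Fin m) (Fin n) EReal) (lam : ℝ)
    (x : Fin n → EReal) : Fin n → EReal :=
  fun i => min ((lam : EReal) + residuated A (mulVec B x) i)
    (-(lam : EReal) + residuated B (mulVec A x) i)

/-- The spectral function `s(lam) = r(h_lam)` of the two-sided eigenproblem `A x = lam + B x`. -/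
def spectralFunction {m n : ℕ} (A B : Matrix (Fin m) (Fin n) EReal) (lam : ℝ) : EReal :=
  spectralRadius (minMaxMap A B lam)

/-- A policy chooses, for every `i`, either a row index `k` with `A k i ≠ -∞` or a row index `k`
with `B k i ≠ -∞`. -/
abbrev Policy {m n : ℕ} (A B : Matrix (Fin m) (Fin n) EReal) : Type :=
  ∀ i : Fin n, {k : Fin m // A k i ≠ ⊥} ⊕ {k : Fin m // B k i ≠ ⊥}

/-- The max-plus matrix `H_lam^(p)` of the policy `p`: its `i`-th row is `lam - A k i + B k ·`
or `-lam - B k i + A k ·`, according to the choice that `p` makes at `i`. -/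
def policyMatrix {m n : ℕ} (A B : Matrix (Fin m) (Fin n) EReal) (p : Policy A B) (lam : ℝ) :
    Matrix (Fin n) (Fin n) EReal :=
  fun i j => match p i with
    | Sum.inl k => (lam : EReal) - A k.1 i + B k.1 j
    | Sum.inr k => -(lam : EReal) - B k.1 i + A k.1 j

/-- The greatest eigenvalue `r(H_lam^(p))` of the matrix of the policy `p`. -/
def policyRadius {m n : ℕ} (A B : Matrix (Fin m) (Fin n) EReal) (p : Policy A B) (lam : ℝ) :
    EReal :=
  spectralRadius (mulVec (policyMatrix A B p lam))

/-- A function on the real line is piecewise affine if the line is covered by finitely many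
closed (possibly unbounded) intervals on each of which the function is affine. -/
def IsPiecewiseAffine (f : ℝ → ℝ) : Prop :=
  ∃ (N : ℕ) (I : Fin N → Set ℝ), (∀ k, IsClosed (I k) ∧ (I k).OrdConnected) ∧
    (⋃ k, I k) = Set.univ ∧ ∀ k, ∃ a b : ℝ, ∀ t ∈ I k, f t = a * t + b

end MaxPlus

end

/-! For a policy, the greatest eigenvalue is the maximal circuit mean of its digraph. The digraph
does not depend on `lam`, and each circuit mean is affine in `lam`, so the radius is a maximum of
finitely many affine functions.

The map `h_lam` is a coordinatewise minimum of policy rows (`minMaxMap_eq_minOp`). An eigenvector of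
it is a sub-eigenvector of every policy matrix, so eigenvalues are at most the least policy radius ρ
(`le_maxCycleMean`). That ρ is attained follows by vanishing discount: `x ↦ f (α x)` is a
contraction for `α < 1`, its normalized fixed point yields a super-eigenvector of some policy, hence
a constant at least ρ (`maxCycleMean_le`), and a limit as `α → 1` in the compact space `EReal` is an
eigenvector. So `s` is a finite minimum of the policy radii and inherits their regularity. A single
action per coordinate gives the matrix case. -/

open Filter Topology Function

namespace MaxPlus

/-! ### Circuit means and sub- or super-eigenvectors -/

section CycleMean

variable {n : ℕ}

open scoped Classical in
/-- The max-plus matrix with finite entries `w i j` on the pairs in `E` and `-∞` elsewhere. -/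
noncomputable def weightedMatrix (E : Fin n → Fin n → Prop) (w : Fin n → Fin n → ℝ) :
    Matrix (Fin n) (Fin n) EReal :=
  fun i j => if E i j then (w i j : EReal) else ⊥

/-- A circuit of the digraph `E`, presented as a periodic point of a choice of successors. -/
abbrev Circuit (E : Fin n → Fin n → Prop) : Type :=
  {c : (Fin n → Fin n) × Fin n // (∀ i, E i (c.1 i)) ∧ c.2 ∈ periodicPts c.1}

/-- The mean weight of a circuit. -/
noncomputable def Circuit.mean {E : Fin n → Fin n → Prop} (c : Circuit E)
    (w : Fin n → Fin n → ℝ) : ℝ :=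
  (∑ t ∈ Finset.range (minimalPeriod c.1.1 c.1.2), w (c.1.1^[t] c.1.2) (c.1.1^[t + 1] c.1.2)) /
    minimalPeriod c.1.1 c.1.2

/-- The maximal circuit mean of a weighted digraph. -/
noncomputable def maxCycleMean (E : Fin n → Fin n → Prop) (w : Fin n → Fin n → ℝ) : ℝ :=
  ⨆ c : Circuit E, c.mean w

theorem exists_iterate_mem_periodicPts {α : Type*} [Finite α] (f : α → α) (x : α) :
    ∃ a, f^[a] x ∈ periodicPts f := by
  obtain ⟨a, b, hab, h⟩ := Finite.exists_ne_map_eq_of_infinite (fun t : ℕ => f^[t] x)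
  wlog hlt : a < b generalizing a b
  · exact this b a hab.symm h.symm (by omega)
  refine ⟨a, b - a, by omega, ?_⟩
  rw [IsPeriodicPt, IsFixedPt, ← iterate_add_apply, Nat.sub_add_cancel hlt.le, h]

theorem nonempty_circuit (hn : 0 < n) {E : Fin n → Fin n → Prop} (hE : ∀ i, ∃ j, E i j) :
    Nonempty (Circuit E) := by
  choose f hf using hE
  obtain ⟨a, ha⟩ := exists_iterate_mem_periodicPts f ⟨0, hn⟩
  exact ⟨⟨(f, _), hf, ha⟩⟩

/-- The potential differences of `x` telescope to zero around the circuit. -/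
theorem Circuit.mean_le {E : Fin n → Fin n → Prop} (c : Circuit E) {w : Fin n → Fin n → ℝ}
    {μ : ℝ} {x : Fin n → ℝ}
    (h : ∀ t, w (c.1.1^[t] c.1.2) (c.1.1^[t + 1] c.1.2) + x (c.1.1^[t + 1] c.1.2) ≤
      μ + x (c.1.1^[t] c.1.2)) : c.mean w ≤ μ := by
  have hp : 0 < minimalPeriod c.1.1 c.1.2 := minimalPeriod_pos_of_mem_periodicPts c.2.2
  rw [mean, div_le_iff₀ (by exact_mod_cast hp)]
  have hs := Finset.sum_le_sum fun t (_ : t ∈ Finset.range (minimalPeriod c.1.1 c.1.2)) =>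
    show w (c.1.1^[t] c.1.2) (c.1.1^[t + 1] c.1.2) ≤
      μ - (x (c.1.1^[t + 1] c.1.2) - x (c.1.1^[t] c.1.2)) by linarith [h t]
  rw [Finset.sum_sub_distrib, Finset.sum_range_sub fun t => x (c.1.1^[t] c.1.2)] at hs
  simp only [iterate_minimalPeriod, iterate_zero, id, sub_self, sub_zero, Finset.sum_const,
    Finset.card_range, nsmul_eq_mul] at hs
  linarith

theorem Circuit.mean_neg {E : Fin n → Fin n → Prop} (c : Circuit E) (w : Fin n → Fin n → ℝ) :
    c.mean (-w) = -c.mean w := by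
  simp [mean, neg_div]

theorem Circuit.le_mean {E : Fin n → Fin n → Prop} (c : Circuit E) {w : Fin n → Fin n → ℝ}
    {μ : ℝ} {x : Fin n → ℝ}
    (h : ∀ t, μ + x (c.1.1^[t] c.1.2) ≤
      w (c.1.1^[t] c.1.2) (c.1.1^[t + 1] c.1.2) + x (c.1.1^[t + 1] c.1.2)) : μ ≤ c.mean w := by
  have := c.mean_le (w := -w) (μ := -μ) (x := -x) fun t => by
    simp only [Pi.neg_apply]; linarith [h t]
  rw [mean_neg] at this
  linarith

theorem Circuit.mean_le_maxCycleMean {E : Fin n → Fin n → Prop} (c : Circuit E)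
    (w : Fin n → Fin n → ℝ) : c.mean w ≤ maxCycleMean E w :=
  le_ciSup (f := fun c : Circuit E => c.mean w) (Set.finite_range _).bddAbove c

/-- A finite super-eigenvector bounds the maximal circuit mean from above. -/
theorem maxCycleMean_le (hn : 0 < n) {E : Fin n → Fin n → Prop} (hE : ∀ i, ∃ j, E i j)
    {w : Fin n → Fin n → ℝ} {μ : ℝ} {x : Fin n → ℝ}
    (h : ∀ i, mulVec (weightedMatrix E w) (fun j => (x j : EReal)) i ≤ (μ : EReal) + x i) :
    maxCycleMean E w ≤ μ := by
  have := nonempty_circuit hn hE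
  refine ciSup_le fun c => c.mean_le (x := x) fun t => ?_
  have h1 := (le_iSup (fun j => weightedMatrix E w (c.1.1^[t] c.1.2) j + (x j : EReal))
    (c.1.1^[t + 1] c.1.2)).trans (h (c.1.1^[t] c.1.2))
  have h2 : E (c.1.1^[t] c.1.2) (c.1.1^[t + 1] c.1.2) := by
    rw [iterate_succ_apply']; exact c.2.1 _
  rw [weightedMatrix, if_pos h2] at h1
  exact_mod_cast h1

/-- A nontrivial sub-eigenvector bounds the maximal circuit mean from below. -/
theorem le_maxCycleMean (hn : 0 < n) {E : Fin n → Fin n → Prop} (hE : ∀ i, ∃ j, E i j)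
    {w : Fin n → Fin n → ℝ} {μ : ℝ} {x : Fin n → EReal} (hx : ∀ i, x i ≠ ⊤)
    (hx' : ∃ i, x i ≠ ⊥)
    (h : ∀ i, (μ : EReal) + x i ≤ mulVec (weightedMatrix E w) x i) :
    μ ≤ maxCycleMean E w := by
  have : Nonempty (Fin n) := ⟨⟨0, hn⟩⟩
  -- A successor attaining the maximum stays in the support of `x`; off the support any arc will do.
  -- Iterating from a support point ends in a circuit inside the support.
  have key : ∀ i, ∃ j, E i j ∧ (x i ≠ ⊥ → x j ≠ ⊥ ∧
      μ + (x i).toReal ≤ w i j + (x j).toReal) := fun i => by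
    by_cases hi : x i = ⊥
    · exact (hE i).imp fun j hj => ⟨hj, fun h => absurd hi h⟩
    obtain ⟨j, hj⟩ := exists_eq_ciSup_of_finite (f := fun j => weightedMatrix E w i j + x j)
    have h1 := h i
    rw [mulVec, ← hj] at h1
    have hne : weightedMatrix E w i j + x j ≠ ⊥ := by
      intro h0
      rw [h0, le_bot_iff, EReal.add_eq_bot_iff] at h1
      simp [hi] at h1
    rw [EReal.add_ne_bot_iff] at hne
    have hEj : E i j := by
      by_contra hc
      exact hne.1 (by rw [weightedMatrix, if_neg hc])
    refine ⟨j, hEj, fun _ => ⟨hne.2, ?_⟩⟩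
    rw [weightedMatrix, if_pos hEj, ← EReal.coe_toReal (hx i) hi,
      ← EReal.coe_toReal (hx j) hne.2] at h1
    exact_mod_cast h1
  choose f hf hf' using key
  obtain ⟨i₀, hi₀⟩ := hx'
  have hit : ∀ t, x (f^[t] i₀) ≠ ⊥ := fun t => by
    induction t with
    | zero => exact hi₀
    | succ t ih => rw [iterate_succ_apply']; exact (hf' _ ih).1
  obtain ⟨a, ha⟩ := exists_iterate_mem_periodicPts f i₀
  let c : Circuit E := ⟨(f, f^[a] i₀), hf, ha⟩
  refine (c.le_mean (x := fun i => (x i).toReal) fun t => ?_).trans (c.mean_le_maxCycleMean w)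
  simp only [c, iterate_succ_apply']
  rw [← iterate_add_apply]
  exact (hf' _ (hit _)).2

end CycleMean

/-! ### Greatest eigenvalue of a min-max map -/

section MinOp

variable {n : ℕ} {K : Fin n → Type*}

open scoped Classical in
/-- The min-max map whose `i`-th coordinate is the minimum, over the actions `k`, of the max-plus
linear forms with coefficients `w i k` supported on `E i k`. -/
noncomputable def minOp (E : ∀ i, K i → Fin n → Prop) (w : ∀ i, K i → Fin n → ℝ)
    (x : Fin n → EReal) : Fin n → EReal :=
  fun i => ⨅ k, ⨆ j, (if E i k j then (w i k j : EReal) else ⊥) + x j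

/-- The max-plus matrix of a selection of actions. -/
noncomputable abbrev selMatrix (E : ∀ i, K i → Fin n → Prop) (w : ∀ i, K i → Fin n → ℝ)
    (q : ∀ i, K i) : Matrix (Fin n) (Fin n) EReal :=
  weightedMatrix (fun i => E i (q i)) (fun i => w i (q i))

variable {E : ∀ i, K i → Fin n → Prop} {w : ∀ i, K i → Fin n → ℝ}

theorem minOp_le_mulVec (q : ∀ i, K i) (x : Fin n → EReal) (i : Fin n) :
    minOp E w x i ≤ mulVec (selMatrix E w q) x i :=
  iInf_le _ (q i)

theorem minOp_mono {x y : Fin n → EReal} (h : x ≤ y) : minOp E w x ≤ minOp E w y :=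
  fun _ => iInf_mono fun _ => iSup_mono fun j => add_le_add le_rfl (h j)

theorem exists_mulVec_eq_minOp [∀ i, Finite (K i)] [∀ i, Nonempty (K i)] (x : Fin n → EReal) :
    ∃ q : ∀ i, K i, ∀ i, mulVec (selMatrix E w q) x i = minOp E w x i := by
  choose q hq using fun i => exists_eq_ciInf_of_finite
    (f := fun k => ⨆ j, (open scoped Classical in if E i k j then (w i k j : EReal) else ⊥) + x j)
  exact ⟨q, fun i => hq i⟩

theorem weightedMatrix_ne_top (E : Fin n → Fin n → Prop) (w : Fin n → Fin n → ℝ) (i j : Fin n) :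
    weightedMatrix E w i j ≠ ⊤ := by
  unfold weightedMatrix
  split_ifs <;> simp

theorem mulVec_ne_top {m : ℕ} {M : Matrix (Fin m) (Fin n) EReal} (hM : ∀ i j, M i j ≠ ⊤)
    {x : Fin n → EReal} (hx : ∀ j, x j ≠ ⊤) (i : Fin m) : mulVec M x i ≠ ⊤ := by
  rcases isEmpty_or_nonempty (Fin n) with h | h
  · simp [mulVec]
  obtain ⟨j, hj⟩ := exists_eq_ciSup_of_finite (f := fun j => M i j + x j)
  rw [mulVec, ← hj]
  exact EReal.add_ne_top (hM i j) (hx j)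

theorem minOp_ne_top [∀ i, Nonempty (K i)] {x : Fin n → EReal} (hx : ∀ j, x j ≠ ⊤) (i : Fin n) :
    minOp E w x i ≠ ⊤ := by
  have q : ∀ i, K i := fun i => Classical.arbitrary _
  exact ((minOp_le_mulVec q x i).trans_lt
    (mulVec_ne_top (weightedMatrix_ne_top _ _) hx i).lt_top).ne

theorem minOp_ne_bot [∀ i, Finite (K i)] [∀ i, Nonempty (K i)] (hE : ∀ i k, ∃ j, E i k j)
    {x : Fin n → EReal} (hx : ∀ j, x j ≠ ⊥) (i : Fin n) : minOp E w x i ≠ ⊥ := by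
  obtain ⟨q, hq⟩ := exists_mulVec_eq_minOp (E := E) (w := w) x
  rw [← hq]
  obtain ⟨j, hj⟩ := hE i (q i)
  refine ne_bot_of_le_ne_bot ?_ (le_iSup (fun j => selMatrix E w q i j + x j) j)
  simp [EReal.add_eq_bot_iff, weightedMatrix, hj, hx]

theorem minOp_coe_add_le [∀ i, Finite (K i)] [∀ i, Nonempty (K i)] (c : ℝ) (x : Fin n → EReal)
    (i : Fin n) : minOp E w (fun j => (c : EReal) + x j) i ≤ c + minOp E w x i := by
  obtain ⟨q, hq⟩ := exists_mulVec_eq_minOp (E := E) (w := w) x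
  rw [← hq]
  refine (minOp_le_mulVec q _ i).trans (iSup_le fun j => ?_)
  rw [add_left_comm]
  exact add_le_add le_rfl (le_iSup (fun j => selMatrix E w q i j + x j) j)

theorem minOp_coe_add [∀ i, Finite (K i)] [∀ i, Nonempty (K i)] (c : ℝ) (x : Fin n → EReal)
    (i : Fin n) : minOp E w (fun j => (c : EReal) + x j) i = c + minOp E w x i := by
  refine (minOp_coe_add_le c x i).antisymm ?_
  have h := minOp_coe_add_le (E := E) (w := w) (-c) (fun j => (c : EReal) + x j) i
  have hc : ∀ d y : EReal, d = ((-c : ℝ) : EReal) → d + (c + y) = y := fun d y hd => by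
    rw [hd, ← add_assoc, ← EReal.coe_add]; simp
  simp only [hc _ _ rfl] at h
  calc (c : EReal) + minOp E w x i ≤ c + (((-c : ℝ) : EReal) +
        minOp E w (fun j => (c : EReal) + x j) i) := add_le_add le_rfl h
    _ = _ := by rw [← add_assoc, ← EReal.coe_add]; simp

theorem tendsto_minOp [∀ i, Finite (K i)] {ι : Type*} {l : Filter ι} {x : ι → Fin n → EReal}
    {y : Fin n → EReal} (h : ∀ j, Tendsto (fun t => x t j) l (𝓝 (y j))) (hy : ∀ j, y j ≠ ⊤)
    (i : Fin n) : Tendsto (fun t => minOp E w (x t) i) l (𝓝 (minOp E w y i)) := by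
  classical
  have := Fintype.ofFinite (K i)
  simp only [minOp, ← Finset.inf_univ_eq_iInf, ← Finset.sup_univ_eq_iSup]
  refine Tendsto.finset_inf_nhds_apply fun k _ => Tendsto.finset_sup_nhds_apply fun j _ => ?_
  have hW : (if E i k j then (w i k j : EReal) else ⊥) ≠ ⊤ := by split_ifs <;> simp
  have hc := EReal.continuousAt_add
    (p := ((if E i k j then (w i k j : EReal) else ⊥), y j)) (.inl hW) (.inr (hy j))
  exact hc.tendsto.comp (tendsto_const_nhds.prodMk_nhds (h j))

/-- Discounted fixed points. -/
theorem exists_discounted [∀ i, Finite (K i)] [∀ i, Nonempty (K i)] (hE : ∀ i k, ∃ j, E i k j)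
    (w : ∀ i, K i → Fin n → ℝ) {α : ℝ} (h0 : 0 ≤ α) (h1 : α < 1) :
    ∃ v : Fin n → ℝ, ∀ i, minOp E w (fun j => ((α * v j : ℝ) : EReal)) i = v i := by
  let g : (Fin n → ℝ) → Fin n → ℝ := fun v i =>
    (minOp E w (fun j => ((α * v j : ℝ) : EReal)) i).toReal
  have hg : ∀ v i, ((g v i : ℝ) : EReal) = minOp E w (fun j => ((α * v j : ℝ) : EReal)) i :=
    fun v i => EReal.coe_toReal (minOp_ne_top (fun _ => EReal.coe_ne_top _) i)
      (minOp_ne_bot hE (fun _ => EReal.coe_ne_bot _) i)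
  have key : ∀ v v' i, g v i - g v' i ≤ α * dist v v' := fun v v' i => by
    rw [sub_le_iff_le_add, ← EReal.coe_le_coe_iff, EReal.coe_add, hg, hg, ← minOp_coe_add]
    refine minOp_mono (fun j => ?_) i
    rw [← EReal.coe_add, EReal.coe_le_coe_iff]
    have := (le_abs_self _).trans (dist_le_pi_dist v v' j)
    nlinarith
  have hc : ContractingWith ⟨α, h0⟩ g := by
    refine ⟨by exact_mod_cast h1, LipschitzWith.of_dist_le_mul fun v v' => ?_⟩
    refine (dist_pi_le_iff (mul_nonneg h0 dist_nonneg)).2 fun i => ?_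
    rw [Real.dist_eq, abs_le]
    have h2 := key v' v i
    rw [dist_comm] at h2
    exact ⟨by change -(α * dist v v') ≤ _; linarith, key v v' i⟩
  refine ⟨hc.fixedPoint g, fun i => ?_⟩
  rw [← hg, hc.fixedPoint_isFixedPt]

theorem exists_normalized_discounted [∀ i, Finite (K i)] [∀ i, Nonempty (K i)] (hn : 0 < n)
    (hE : ∀ i k, ∃ j, E i k j) (w : ∀ i, K i → Fin n → ℝ) {α : ℝ} (h0 : 0 ≤ α) (h1 : α < 1) :
    ∃ (u : Fin n → ℝ) (c : ℝ), (∀ i, u i ≤ 0) ∧ (∃ i, u i = 0) ∧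
      ∀ i, minOp E w (fun j => ((α * u j : ℝ) : EReal)) i = c + u i := by
  obtain ⟨v, hv⟩ := exists_discounted hE w h0 h1
  have : Nonempty (Fin n) := ⟨⟨0, hn⟩⟩
  obtain ⟨i₀, hi₀⟩ := Finite.exists_max v
  -- Subtracting the maximum of `v` shifts the argument by `-α * v i₀` and the value by `-v i₀`; the
  -- constant is the discrepancy.
  refine ⟨fun i => v i - v i₀, (1 - α) * v i₀, fun i => sub_nonpos.2 (hi₀ i),
    ⟨i₀, sub_self _⟩, fun i => ?_⟩
  have : (fun j => ((α * (v j - v i₀) : ℝ) : EReal)) =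
      fun j => ((-(α * v i₀) : ℝ) : EReal) + ((α * v j : ℝ) : EReal) := by
    funext j
    rw [← EReal.coe_add]
    congr 1
    ring
  rw [this, minOp_coe_add, hv, ← EReal.coe_add, ← EReal.coe_add]
  congr 1
  ring

theorem eigenvalue_le_maxCycleMean (hn : 0 < n) (hE : ∀ i k, ∃ j, E i k j) {μ : EReal}
    (hμ : μ ∈ eigenvalues (minOp E w)) (q : ∀ i, K i) :
    μ ≤ (maxCycleMean (fun i => E i (q i)) (fun i => w i (q i)) : EReal) := by
  obtain ⟨hμt, x, hx, hx', he⟩ := hμ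
  induction μ with
  | bot => exact bot_le
  | top => exact absurd rfl hμt
  | coe μ =>
    exact EReal.coe_le_coe_iff.2 (le_maxCycleMean hn (fun i => hE i (q i)) hx hx' fun i =>
      (he i).trans_le (minOp_le_mulVec q x i))

/-- The greatest eigenvalue of a min-max map is the least maximal circuit mean of its
selections. -/
theorem exists_isGreatest_eigenvalues_minOp [∀ i, Finite (K i)] [∀ i, Nonempty (K i)]
    (hn : 0 < n) (hE : ∀ i k, ∃ j, E i k j) (w : ∀ i, K i → Fin n → ℝ) :
    IsGreatest (eigenvalues (minOp E w))
      ((⨅ q : ∀ i, K i, maxCycleMean (fun i => E i (q i)) (fun i => w i (q i)) : ℝ) : EReal) := by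
  obtain ⟨q₀, hq₀⟩ := exists_eq_ciInf_of_finite
    (f := fun q : ∀ i, K i => maxCycleMean (fun i => E i (q i)) (fun i => w i (q i)))
  set ρ : ℝ := ⨅ q : ∀ i, K i, maxCycleMean (fun i => E i (q i)) (fun i => w i (q i)) with hρ
  have hub : ∀ μ ∈ eigenvalues (minOp E w), μ ≤ (ρ : EReal) := fun μ hμ => by
    rw [← hq₀]; exact eigenvalue_le_maxCycleMean hn hE hμ q₀
  refine ⟨?_, hub⟩
  have : Nonempty (Fin n) := ⟨⟨0, hn⟩⟩
  let α : ℕ → ℝ := fun t => 1 - 1 / ((t : ℝ) + 1)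
  have hα0 : ∀ t, 0 ≤ α t := fun t => by
    have : 1 / ((t : ℝ) + 1) ≤ 1 := by
      rw [div_le_one (by positivity)]; linarith [t.cast_nonneg (α := ℝ)]
    simp only [α]; linarith
  have hα1 : ∀ t, α t < 1 := fun t => by
    have : 0 < 1 / ((t : ℝ) + 1) := by positivity
    simp only [α]; linarith
  have hα : Tendsto α atTop (𝓝 1) := by
    simpa [α] using (tendsto_one_div_add_atTop_nhds_zero_nat (𝕜 := ℝ)).const_sub 1
  choose u c hu hu0 huc using fun t => exists_normalized_discounted hn hE w (hα0 t) (hα1 t)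
  -- For a minimizing selection `α u` is a super-eigenvector: `c + u ≤ c + α u`, because `u ≤ 0` and
  -- `α < 1`.
  have hlow : ∀ t, ρ ≤ c t := fun t => by
    obtain ⟨q, hq⟩ := exists_mulVec_eq_minOp (E := E) (w := w)
      (fun j => ((α t * u t j : ℝ) : EReal))
    refine (ciInf_le (Set.finite_range _).bddBelow q).trans
      (maxCycleMean_le hn (fun i => hE i (q i)) (x := fun j => α t * u t j) fun i => ?_)
    rw [hq, huc, ← EReal.coe_add, ← EReal.coe_add, EReal.coe_le_coe_iff]
    nlinarith [hu t i, hα1 t]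
  obtain ⟨i₁, hi₁⟩ := Finite.exists_max (minOp E w fun _ => 0)
  have hupp : ∀ t, (c t : EReal) ≤ minOp E w (fun _ => 0) i₁ := fun t => by
    obtain ⟨i, hi⟩ := hu0 t
    have h := huc t i
    rw [hi, EReal.coe_zero, add_zero] at h
    rw [← h]
    refine (minOp_mono (fun j => ?_) i).trans (hi₁ i)
    exact EReal.coe_nonpos.2 (mul_nonpos_of_nonneg_of_nonpos (hα0 t) (hu t j))
  -- An ultrafilter makes all coordinates and `c` converge at once. Coordinates may tend to `⊥`, but
  -- not all of them, since some `u t i` is zero for every `t`.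
  let l : Ultrafilter ℕ := hyperfilter ℕ
  have hl : (l : Filter ℕ) ≤ atTop := Nat.hyperfilter_le_atTop
  have hlim : ∀ a : ℕ → EReal, ∃ y, Tendsto a l (𝓝 y) := fun a => by
    obtain ⟨y, -, hy⟩ := isCompact_univ.ultrafilter_le_nhds (l.map a) (by simp)
    exact ⟨y, hy⟩
  obtain ⟨μ, hμ⟩ := hlim fun t => (c t : EReal)
  choose y hy using fun i => hlim fun t => (u t i : EReal)
  have hy0 : ∀ i, y i ≤ 0 := fun i =>
    le_of_tendsto (hy i) (Eventually.of_forall fun t => by exact_mod_cast hu t i)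
  have hyt : ∀ i, y i ≠ ⊤ := fun i => ((hy0 i).trans_lt EReal.zero_lt_top).ne
  have hyb : ∃ i, y i ≠ ⊥ := by
    by_contra! hb
    have : ∀ᶠ t in (l : Filter ℕ), ∀ i, (u t i : EReal) < 0 := eventually_all.2 fun i =>
      (hy i).eventually_lt_const (by rw [hb i]; exact EReal.bot_lt_zero)
    obtain ⟨t, ht⟩ := this.exists
    obtain ⟨i, hi⟩ := hu0 t
    simpa [hi] using ht i
  have hμt : μ ≠ ⊤ := ((le_of_tendsto hμ (Eventually.of_forall hupp)).trans_lt
    (minOp_ne_top (by simp) i₁).lt_top).ne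
  have hμρ : (ρ : EReal) ≤ μ :=
    ge_of_tendsto hμ (Eventually.of_forall fun t => by exact_mod_cast hlow t)
  have hαu : ∀ i, Tendsto (fun t => ((α t * u t i : ℝ) : EReal)) l (𝓝 (y i)) := fun i => by
    have hc := EReal.continuousAt_mul (p := (((1 : ℝ) : EReal), y i)) (by simp) (by simp)
      (.inl (EReal.coe_ne_bot 1)) (.inl (EReal.coe_ne_top 1))
    have h := hc.tendsto.comp
      (((EReal.tendsto_coe.2 (hα.mono_left hl))).prodMk_nhds (hy i))
    simpa [Function.comp_def] using h
  have heig : μ ∈ eigenvalues (minOp E w) := by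
    refine ⟨hμt, y, hyt, hyb, fun i => ?_⟩
    have hc := EReal.continuousAt_add (p := (μ, y i)) (.inl hμt) (.inr (hyt i))
    have h1 := hc.tendsto.comp (hμ.prodMk_nhds (hy i))
    refine tendsto_nhds_unique h1 ((tendsto_minOp hαu hyt i).congr fun t => ?_)
    exact huc t i
  rwa [(hub μ heig).antisymm hμρ] at heig

theorem isGreatest_eigenvalues_mulVec (hn : 0 < n) {E : Fin n → Fin n → Prop}
    (hE : ∀ i, ∃ j, E i j) (w : Fin n → Fin n → ℝ) :
    IsGreatest (eigenvalues (mulVec (weightedMatrix E w))) (maxCycleMean E w : EReal) := by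
  have h := exists_isGreatest_eigenvalues_minOp (K := fun _ => Unit) hn
    (E := fun i _ => E i) (fun i _ => hE i) (fun i _ => w i)
  rw [ciInf_const] at h
  have he : minOp (K := fun _ => Unit) (fun i _ => E i) (fun i _ => w i) =
      mulVec (weightedMatrix E w) := by
    funext x i
    exact iInf_const
  rwa [he] at h

end MinOp

/-! ### Finite maxima and minima of piecewise-affine functions -/

section PiecewiseAffine

theorem IsPiecewiseAffine.of_finite {ι : Type*} [Finite ι] {f : ℝ → ℝ} (I : ι → Set ℝ)
    (hI : ∀ k, IsClosed (I k) ∧ (I k).OrdConnected) (hU : ∀ t, ∃ k, t ∈ I k)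
    (hf : ∀ k, ∃ a b : ℝ, ∀ t ∈ I k, f t = a * t + b) : IsPiecewiseAffine f := by
  obtain ⟨N, ⟨e⟩⟩ := Finite.exists_equiv_fin ι
  refine ⟨N, fun k => I (e.symm k), fun k => hI _, ?_, fun k => hf _⟩
  refine Set.eq_univ_of_forall fun t => Set.mem_iUnion.2 ?_
  obtain ⟨k, hk⟩ := hU t
  exact ⟨e k, by simpa using hk⟩

theorem isPiecewiseAffine_affine (a b : ℝ) : IsPiecewiseAffine fun t => a * t + b :=
  .of_finite (fun _ : Unit => Set.univ) (fun _ => ⟨isClosed_univ, Set.ordConnected_univ⟩)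
    (fun _ => ⟨(), trivial⟩) fun _ => ⟨a, b, fun _ _ => rfl⟩

theorem IsPiecewiseAffine.neg {f : ℝ → ℝ} (hf : IsPiecewiseAffine f) : IsPiecewiseAffine (-f) := by
  obtain ⟨N, I, h1, h2, h3⟩ := hf
  refine ⟨N, I, h1, h2, fun k => ?_⟩
  obtain ⟨a, b, h⟩ := h3 k
  exact ⟨-a, -b, fun t ht => by rw [Pi.neg_apply, h t ht]; ring⟩

theorem isClosed_ordConnected_affine_le (a b a' b' : ℝ) :
    IsClosed {t : ℝ | a * t + b ≤ a' * t + b'} ∧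
      {t : ℝ | a * t + b ≤ a' * t + b'}.OrdConnected := by
  refine ⟨isClosed_le (by fun_prop) (by fun_prop), ⟨fun x hx y hy z hz => ?_⟩⟩
  simp only [Set.mem_ofPred_eq] at *
  rcases le_total a a' with h | h
  · nlinarith [mul_le_mul_of_nonneg_left hz.1 (sub_nonneg.2 h)]
  · nlinarith [mul_le_mul_of_nonneg_left hz.2 (sub_nonneg.2 h)]

theorem IsPiecewiseAffine.sup {f g : ℝ → ℝ} (hf : IsPiecewiseAffine f)
    (hg : IsPiecewiseAffine g) : IsPiecewiseAffine (f ⊔ g) := by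
  obtain ⟨N, I, hI, hIU, hfI⟩ := hf
  obtain ⟨N', J, hJ, hJU, hgJ⟩ := hg
  choose a b hab using hfI
  choose a' b' hab' using hgJ
  -- Pairwise intersections of pieces are cut where the two affine functions cross.
  refine .of_finite (ι := (Fin N × Fin N') ⊕ (Fin N × Fin N'))
    (Sum.elim (fun k => I k.1 ∩ J k.2 ∩ {t | a k.1 * t + b k.1 ≤ a' k.2 * t + b' k.2})
      (fun k => I k.1 ∩ J k.2 ∩ {t | a' k.2 * t + b' k.2 ≤ a k.1 * t + b k.1})) ?_ ?_ ?_
  · have h : ∀ (k : Fin N × Fin N') (S : Set ℝ), IsClosed S ∧ S.OrdConnected →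
        IsClosed (I k.1 ∩ J k.2 ∩ S) ∧ (I k.1 ∩ J k.2 ∩ S).OrdConnected := fun k S hS =>
      ⟨((hI _).1.inter (hJ _).1).inter hS.1, ((hI _).2.inter (hJ _).2).inter hS.2⟩
    rintro (k | k)
    · exact h k _ (isClosed_ordConnected_affine_le _ _ _ _)
    · exact h k _ (isClosed_ordConnected_affine_le _ _ _ _)
  · intro t
    obtain ⟨k, hk⟩ := Set.mem_iUnion.1 (hIU.symm ▸ Set.mem_univ t)
    obtain ⟨l, hl⟩ := Set.mem_iUnion.1 (hJU.symm ▸ Set.mem_univ t)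
    rcases le_total (a k * t + b k) (a' l * t + b' l) with h | h
    · exact ⟨.inl (k, l), ⟨hk, hl⟩, h⟩
    · exact ⟨.inr (k, l), ⟨hk, hl⟩, h⟩
  · rintro (k | k)
    · refine ⟨a' k.2, b' k.2, fun t ht => ?_⟩
      rw [Pi.sup_apply, hab _ t ht.1.1, hab' _ t ht.1.2]
      exact sup_eq_right.2 ht.2
    · refine ⟨a k.1, b k.1, fun t ht => ?_⟩
      rw [Pi.sup_apply, hab _ t ht.1.1, hab' _ t ht.1.2]
      exact sup_eq_left.2 ht.2

theorem IsPiecewiseAffine.inf {f g : ℝ → ℝ} (hf : IsPiecewiseAffine f)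
    (hg : IsPiecewiseAffine g) : IsPiecewiseAffine (f ⊓ g) := by
  have h := (hf.neg.sup hg.neg).neg
  rwa [neg_sup, neg_neg, neg_neg] at h

theorem lipschitzWith_affine (a b : ℝ) : LipschitzWith ‖a‖₊ fun t : ℝ => a * t + b :=
  .of_dist_le_mul fun x y => by
    rw [dist_add_right, Real.dist_eq, ← mul_sub, abs_mul, Real.dist_eq]; rfl

theorem convexOn_affine (a b : ℝ) : ConvexOn ℝ Set.univ fun t : ℝ => a * t + b :=
  ⟨convex_univ, fun x _ y _ c d _ _ h => by
    simp only [smul_eq_mul]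
    exact le_of_eq (by linear_combination -b * h)⟩

theorem ciSup_induction {ι : Type*} [Finite ι] [Nonempty ι] {P : (ℝ → ℝ) → Prop}
    (hP : ∀ f, P f → ∀ g, P g → P (f ⊔ g)) {f : ι → ℝ → ℝ} (hf : ∀ i, P (f i)) :
    P fun t => ⨆ i, f i t := by
  have := Fintype.ofFinite ι
  convert! Finset.sup'_induction Finset.univ_nonempty f hP fun i _ => hf i using 1
  funext t
  rw [Finset.sup'_apply, Finset.sup'_univ_eq_ciSup]

theorem ciInf_induction {ι : Type*} [Finite ι] [Nonempty ι] {P : (ℝ → ℝ) → Prop}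
    (hP : ∀ f, P f → ∀ g, P g → P (f ⊓ g)) {f : ι → ℝ → ℝ} (hf : ∀ i, P (f i)) :
    P fun t => ⨅ i, f i t := by
  have := Fintype.ofFinite ι
  convert! Finset.inf'_induction Finset.univ_nonempty f hP fun i _ => hf i using 1
  funext t
  rw [Finset.inf'_apply, Finset.inf'_univ_eq_ciInf]

end PiecewiseAffine

/-! ### Policies as selections of actions -/

section Policy

variable {m n : ℕ} (A B : Matrix (Fin m) (Fin n) EReal)

/-- The admissible choices of a policy at the coordinate `i`. -/
abbrev Action (i : Fin n) : Type := {k : Fin m // A k i ≠ ⊥} ⊕ {k : Fin m // B k i ≠ ⊥}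

/-- The finite positions of the matrix row selected by an action. -/
def actionSupport (i : Fin n) : Action A B i → Fin n → Prop
  | .inl k => fun j => B k.1 j ≠ ⊥
  | .inr k => fun j => A k.1 j ≠ ⊥

/-- The dependence on the parameter of the matrix row selected by an action. -/
def actionSlope (i : Fin n) : Action A B i → ℝ
  | .inl _ => 1
  | .inr _ => -1

/-- The finite entries, at parameter zero, of the matrix row selected by an action. -/
def actionConst (i : Fin n) : Action A B i → Fin n → ℝ
  | .inl k => fun j => (B k.1 j).toReal - (A k.1 i).toReal
  | .inr k => fun j => (A k.1 j).toReal - (B k.1 i).toReal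

/-- The finite entries of the matrix row selected by an action. -/
def actionWeight (lam : ℝ) (i : Fin n) (k : Action A B i) (j : Fin n) : ℝ :=
  actionSlope A B i k * lam + actionConst A B i k j

variable {A B}

theorem coe_sub_add_eq_ite (l : ℝ) {a b : EReal} (ha : a ≠ ⊤) (ha' : a ≠ ⊥) (hb : b ≠ ⊤)
    [Decidable (b ≠ ⊥)] :
    (l : EReal) - a + b = if b ≠ ⊥ then ((l + (b.toReal - a.toReal) : ℝ) : EReal) else ⊥ := by
  split_ifs with h
  · lift a to ℝ using ⟨ha, ha'⟩
    lift b to ℝ using ⟨hb, h⟩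
    rw [← EReal.coe_sub, ← EReal.coe_add, EReal.toReal_coe, EReal.toReal_coe]
    congr 1
    ring
  · rw [not_not.1 h, EReal.add_bot]

open scoped Classical in
theorem policyMatrix_apply (hA : ∀ i j, A i j ≠ ⊤) (hB : ∀ i j, B i j ≠ ⊤) (p : Policy A B)
    (lam : ℝ) (i j : Fin n) : policyMatrix A B p lam i j =
      if actionSupport A B i (p i) j then (actionWeight A B lam i (p i) j : EReal) else ⊥ := by
  unfold policyMatrix actionWeight
  rcases p i with k | k
  · refine (coe_sub_add_eq_ite lam (hA _ _) k.2 (hB _ _)).trans ?_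
    simp [actionSupport, actionSlope, actionConst]
  · refine (coe_sub_add_eq_ite (-lam) (hB _ _) k.2 (hA _ _)).trans ?_
    simp [actionSupport, actionSlope, actionConst]

theorem policyMatrix_eq_selMatrix (hA : ∀ i j, A i j ≠ ⊤) (hB : ∀ i j, B i j ≠ ⊤)
    (p : Policy A B) (lam : ℝ) :
    policyMatrix A B p lam = selMatrix (actionSupport A B) (actionWeight A B lam) p := by
  funext i j
  exact policyMatrix_apply hA hB p lam i j

/-- Adding a real number, as an order isomorphism of `EReal`. -/
noncomputable def addRealIso (c : ℝ) : EReal ≃o EReal where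
  toFun x := c + x
  invFun x := ((-c : ℝ) : EReal) + x
  left_inv x := by beta_reduce; rw [← add_assoc, ← EReal.coe_add]; simp
  right_inv x := by beta_reduce; rw [← add_assoc, ← EReal.coe_add]; simp
  map_rel_iff' := (EReal.addLECancellable_coe c).add_le_add_iff_left

theorem coe_add_iInf {ι : Sort*} (c : ℝ) (f : ι → EReal) : (c : EReal) + ⨅ i, f i = ⨅ i, c + f i :=
  (addRealIso c).map_iInf f

theorem coe_add_iSup {ι : Sort*} (c : ℝ) (f : ι → EReal) : (c : EReal) + ⨆ i, f i = ⨆ i, c + f i :=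
  (addRealIso c).map_iSup f

/-- Under the residuation convention a row with `M k i = ⊥` contributes `⊤`, so only admissible
choices affect the infimum. -/
theorem coe_add_residuated_mulVec {M N : Matrix (Fin m) (Fin n) EReal} (hM : ∀ i j, M i j ≠ ⊤)
    (lam : ℝ) (x : Fin n → EReal) (i : Fin n) :
    (lam : EReal) + residuated M (mulVec N x) i =
      ⨅ k : {k : Fin m // M k i ≠ ⊥}, ⨆ j, ((lam : EReal) - M k.1 i + N k.1 j) + x j := by
  let f : Fin m → EReal := fun k => (lam : EReal) + -(M k i + -(mulVec N x k))
  let g : {k : Fin m // M k i ≠ ⊥} → EReal := fun k =>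
    ⨆ j, ((lam : EReal) - M k.1 i + N k.1 j) + x j
  have hk : ∀ k : {k : Fin m // M k i ≠ ⊥}, f k.1 = g k := fun ⟨k, hk⟩ => by
    simp only [f, g, mulVec]
    lift M k i to ℝ using ⟨hM k i, hk⟩ with a
    rw [EReal.neg_add (by simp) (by simp), sub_eq_add_neg, neg_neg, ← add_assoc,
      ← sub_eq_add_neg, ← EReal.coe_sub, coe_add_iSup]
    simp only [add_assoc]
  change (lam : EReal) + ⨅ k, -(M k i + -(mulVec N x k)) = ⨅ k, g k
  rw [coe_add_iInf]
  change ⨅ k, f k = _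
  refine le_antisymm (le_iInf fun k => (iInf_le f k.1).trans (hk k).le) (le_iInf fun k => ?_)
  by_cases h : M k i = ⊥
  · simp [f, h]
  · exact (iInf_le g ⟨k, h⟩).trans (hk ⟨k, h⟩).ge

open scoped Classical in
theorem minMaxMap_eq_minOp (hA : ∀ i j, A i j ≠ ⊤) (hB : ∀ i j, B i j ≠ ⊤) (lam : ℝ) :
    minMaxMap A B lam = minOp (actionSupport A B) (actionWeight A B lam) := by
  funext x i
  rw [minMaxMap, coe_add_residuated_mulVec hA, ← EReal.coe_neg, coe_add_residuated_mulVec hB,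
    minOp, iInf_sum]
  refine congrArg₂ min (iInf_congr fun k => iSup_congr fun j => ?_)
    (iInf_congr fun k => iSup_congr fun j => ?_)
  · rw [coe_sub_add_eq_ite lam (hA _ _) k.2 (hB _ _)]
    simp [actionSupport, actionSlope, actionConst, actionWeight]
  · rw [coe_sub_add_eq_ite (-lam) (hB _ _) k.2 (hA _ _)]
    simp [actionSupport, actionSlope, actionConst, actionWeight]

/-- The slope is the mean of the signs `±1` of the actions along the circuit. -/
theorem Circuit.exists_mean_actionWeight {E : Fin n → Fin n → Prop} (c : Circuit E)
    (p : Policy A B) : ∃ a b : ℝ, (fun lam => c.mean fun i => actionWeight A B lam i (p i)) =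
      fun lam => a * lam + b := by
  refine ⟨c.mean fun i _ => actionSlope A B i (p i), c.mean fun i => actionConst A B i (p i), ?_⟩
  funext lam
  simp only [mean, actionWeight, Finset.sum_add_distrib, ← Finset.sum_mul]
  ring

end Policy

end MaxPlus

/-! ### Policy radii and the spectral function -/

theorem mainTheorem3 {m n : ℕ} (hn : 0 < n) (A B : Matrix (Fin m) (Fin n) EReal)
    (hA : ∀ i j, A i j ≠ ⊤) (hB : ∀ i j, B i j ≠ ⊤)
    (hArow : ∀ i, ∃ j, A i j ≠ ⊥) (hBrow : ∀ i, ∃ j, B i j ≠ ⊥)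
    (hcol : ∀ j, ∃ i, A i j ≠ ⊥ ∨ B i j ≠ ⊥) :
    (∀ p : MaxPlus.Policy A B,
      (∀ lam : ℝ, IsGreatest
        (MaxPlus.eigenvalues (MaxPlus.mulVec (MaxPlus.policyMatrix A B p lam)))
        (MaxPlus.policyRadius A B p lam)) ∧
      ∃ ρ : ℝ → ℝ, (∀ lam : ℝ, MaxPlus.policyRadius A B p lam = (ρ lam : EReal)) ∧
        ConvexOn ℝ Set.univ ρ ∧ MaxPlus.IsPiecewiseAffine ρ ∧
        ∃ K : NNReal, LipschitzWith K ρ) ∧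
    Finite (MaxPlus.Policy A B) ∧
    (∀ lam : ℝ, IsGreatest (MaxPlus.eigenvalues (MaxPlus.minMaxMap A B lam))
      (MaxPlus.spectralFunction A B lam)) ∧
    (∀ lam : ℝ, IsLeast (Set.range fun p : MaxPlus.Policy A B => MaxPlus.policyRadius A B p lam)
      (MaxPlus.spectralFunction A B lam)) ∧
    ∃ σ : ℝ → ℝ, (∀ lam : ℝ, MaxPlus.spectralFunction A B lam = (σ lam : EReal)) ∧
      MaxPlus.IsPiecewiseAffine σ ∧ ∃ K : NNReal, LipschitzWith K σ := by
  open MaxPlus in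
  -- Finite rows give every action a nonempty support; the column hypothesis gives every coordinate
  -- an action.
  have hE : ∀ i k, ∃ j, actionSupport A B i k j := by
    rintro i (k | k)
    · exact hBrow k.1
    · exact hArow k.1
  have hK : ∀ i, Nonempty (Action A B i) := fun i => by
    obtain ⟨k, h | h⟩ := hcol i
    · exact ⟨.inl ⟨k, h⟩⟩
    · exact ⟨.inr ⟨k, h⟩⟩
  let ρ : Policy A B → ℝ → ℝ := fun p lam =>
    maxCycleMean (fun i => actionSupport A B i (p i)) fun i => actionWeight A B lam i (p i)
  have hp : ∀ p lam, IsGreatest (eigenvalues (mulVec (policyMatrix A B p lam)))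
      (ρ p lam : EReal) := fun p lam => by
    rw [policyMatrix_eq_selMatrix hA hB]
    exact isGreatest_eigenvalues_mulVec hn (fun i => hE i (p i)) _
  have hpr : ∀ p lam, policyRadius A B p lam = (ρ p lam : EReal) := fun p lam =>
    (hp p lam).isLUB.sSup_eq
  have hs : ∀ lam, IsGreatest (eigenvalues (minMaxMap A B lam))
      ((⨅ p, ρ p lam : ℝ) : EReal) := fun lam => by
    rw [minMaxMap_eq_minOp hA hB]
    exact exists_isGreatest_eigenvalues_minOp hn hE _
  have hsr : ∀ lam, spectralFunction A B lam = ((⨅ p, ρ p lam : ℝ) : EReal) := fun lam =>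
    (hs lam).isLUB.sSup_eq
  have hρ : ∀ p, ConvexOn ℝ Set.univ (ρ p) ∧ IsPiecewiseAffine (ρ p) ∧
      ∃ K : NNReal, LipschitzWith K (ρ p) := fun p => by
    have := nonempty_circuit hn fun i => hE i (p i)
    refine ciSup_induction (P := fun f => ConvexOn ℝ Set.univ f ∧ IsPiecewiseAffine f ∧
      ∃ K : NNReal, LipschitzWith K f) ?_ fun c => ?_
    · rintro f ⟨h1, h2, K, h3⟩ g ⟨h1', h2', K', h3'⟩
      exact ⟨h1.sup h1', h2.sup h2', _, h3.max h3'⟩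
    · obtain ⟨a, b, h⟩ := c.exists_mean_actionWeight p
      rw [h]
      exact ⟨convexOn_affine a b, isPiecewiseAffine_affine a b, _, lipschitzWith_affine a b⟩
  refine ⟨fun p => ⟨fun lam => hpr p lam ▸ hp p lam, ρ p, hpr p, hρ p⟩, inferInstance,
    fun lam => hsr lam ▸ hs lam, fun lam => ?_, _, hsr, ?_⟩
  · simp only [hsr, hpr]
    obtain ⟨q, hq⟩ := exists_eq_ciInf_of_finite (f := fun p => ρ p lam)
    refine ⟨⟨q, congrArg _ hq⟩, ?_⟩
    rintro _ ⟨p, rfl⟩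
    exact EReal.coe_le_coe_iff.2 (ciInf_le (Set.finite_range _).bddBelow p)
  · refine ciInf_induction (P := fun f => IsPiecewiseAffine f ∧ ∃ K : NNReal, LipschitzWith K f)
      ?_ fun p => (hρ p).2
    rintro f ⟨h2, K, h3⟩ g ⟨h2', K', h3'⟩
    exact ⟨h2.inf h2', _, h3.min h3'⟩
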